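/- Let $R$ be a finite commutative ring with $1$ and let $I$ be a proper nonzero ideal of $R$. Let $\Gamma_I(R)$ be the simple graph with vertex set $\{x\in R\setminus I : xy\in I \text{ for some } y\in R\setminus I\}$ in which two distinct vertices $x,y$ are adjacent if and only if $xy\in I$. For a finite graph $G$, let $\gamma(G)$ denote its genus, i.e. the least $g\ge 0$ such that $G$ can be drawn without crossings on the sphere with $g$ handles. (i) If $R/I$ is isomorphic to one of the rings $$\text{(a) } \mathbb{Z}_4[x,y]/(x^2,\,y^2,\,xy-2),\qquad \text{(b) } \mathbb{Z}_2[x,y]/(x^2,\,y^2),\qquad \text{(c) } \mathbb{Z}_4[x]/(x^2),$$ then $\gamma(\Gamma_I(R))\ge 2$. (ii) If $R/I$ is isomorphic to one of the rings $$\text{(a) } \mathbb{Z}_2[x,y]/(x^3,\,xy,\,y^2-x^2),\qquad \text{(b) } \mathbb{Z}_4[x]/(x^3,\,x^2-2x),$$ $$\text{(c) } \mathbb{Z}_4[x,y]/(x^3,\,x^2-2,\,xy,\,y^2-2),\qquad \text{(d) } \mathbb{Z}_8[x]/(x^2-4,\,2x),$$ then $\gamma(\Gamma_I(R))\ge 2$.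 -/

import Mathlib

namespace SimpleGraph

/-- A rotation system on a graph: for every vertex `v`, a cyclic ordering of the edges at `v`.
The edges at `v` are encoded as the darts (oriented edges) that start at `v`; `rot` sends a dart to
the next one around its starting vertex. Up to orientation-preserving homeomorphism, the rotation
systems of a finite connected graph are its cellular embeddings in closed oriented surfaces: the
faces are the discs glued along the face walks below. -/
structure RotationSystem {V : Type*} (G : SimpleGraph V) where
  rot : Equiv.Perm G.Dart
  fst_rot : ∀ d : G.Dart, (rot d).fst = d.fst
  sameCycle_rot : ∀ d e : G.Dart, d.fst = e.fst → rot.SameCycle d e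

namespace RotationSystem

variable {V : Type*} {G : SimpleGraph V}

/-- The face-tracing permutation: walk along a dart, then leave along the next dart around the
vertex that has been reached. -/
def facePerm (ρ : G.RotationSystem) : Equiv.Perm G.Dart :=
  (Function.Involutive.toPerm Dart.symm Dart.symm_involutive).trans ρ.rot

/-- The face walks that contain at least one edge: the cycles of the face-tracing permutation. -/
def FaceWalk (ρ : G.RotationSystem) : Type _ :=
  Quotient (Equiv.Perm.SameCycle.setoid ρ.facePerm)

/-- The number of faces, summed over the surfaces that carry the connected components of `G`.
A component that is an isolated vertex lies on a sphere and has one face, without edges. -/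
noncomputable def numFaces (ρ : G.RotationSystem) : ℕ :=
  Nat.card ρ.FaceWalk + Nat.card {v : V // ∀ w, ¬ G.Adj v w}

/-- The surface of the rotation system has genus `g`, that is `n - m + f = 2 - 2g` for a connected
graph with `n` vertices, `m` edges and `f` faces. When `G` is disconnected, each component has its
own surface, `g` is the sum of their genera (the genus of their connected sum), and `2` becomes
`2c`, with `c` the number of components. -/
def HasGenus (ρ : G.RotationSystem) (g : ℕ) : Prop :=
  (Nat.card V : ℤ) - Nat.card G.edgeSet + ρ.numFaces = 2 * Nat.card G.ConnectedComponent - 2 * g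

end RotationSystem

/-- The finite graph `G` can be drawn without crossings on the sphere with `g` handles. Handles that
the drawing does not use may be present, hence `h ≤ g`. -/
def IsDrawableOnGenus {V : Type*} [Finite V] (G : SimpleGraph V) (g : ℕ) : Prop :=
  ∃ h ≤ g, ∃ ρ : G.RotationSystem, ρ.HasGenus h

/-- The genus of a finite graph: the least `g` such that the graph can be drawn without crossings
on the sphere with `g` handles. -/
noncomputable def genus {V : Type*} [Finite V] (G : SimpleGraph V) : ℕ∞ :=
  ⨅ (g : ℕ) (_ : G.IsDrawableOnGenus g), (g : ℕ∞)

end SimpleGraph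

/-- The zero-divisor graph of `R` with respect to the ideal `I`: the vertices are the `x ∉ I` with
`x * y ∈ I` for some `y ∉ I`, and distinct vertices `x`, `y` are adjacent when `x * y ∈ I`. -/
def zeroDivisorGraph {R : Type*} [CommRing R] (I : Ideal R) :
    SimpleGraph {x : R // x ∉ I ∧ ∃ y, y ∉ I ∧ x * y ∈ I} where
  Adj x y := x ≠ y ∧ (x : R) * (y : R) ∈ I
  symm := ⟨fun x y h => ⟨h.1.symm, by rw [mul_comm]; exact h.2⟩⟩
  loopless := ⟨fun _ h => h.1 rfl⟩

/-! ### Face walks and the Euler bound. -/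

namespace SimpleGraph

namespace RotationSystem

variable {V : Type*} {G : SimpleGraph V}

/-! The bound comes from counting edges. If every vertex has degree at least two, every face walk
has length at least three, so `3f ≤ 2m`. With `n - m + f = 2c - 2h` and `c ≥ 1`, having `m > 3n`
forces `h ≥ 2` (`two_le_genus_of_card_lt`).

All seven quotients have the same shape (`IsLocalTriple`): the maximal ideal consists of the eight
combinations of `u`, `v`, `s` with coefficients 0 and 1, `s` spans the socle, and multiplication is
a nondegenerate symmetric bilinear form over the field of two elements in the `u`, `v` coordinates,
with values in `{0, s}`. Hence there are 7 nonzero zero divisors and 25 ordered pairs of them with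
product zero, whichever of the two forms occurs.

In the graph of `I` each zero divisor is replaced by `k = |I| ≥ 2` vertices. So `n = 7k`, and
discarding the at most `7k` diagonal pairs leaves `2m ≥ 25k² - 7k`. This exceeds `6n = 42k` because
`25k ≥ 50 > 49`.

It remains to exhibit a triple in each ring. The only delicate point is `s ≠ 0`, shown by an
additive functional that vanishes on the defining ideal but not on a representative of `s`. -/

theorem facePerm_apply (ρ : G.RotationSystem) (d : G.Dart) : ρ.facePerm d = ρ.rot d.symm := rfl

theorem fst_facePerm (ρ : G.RotationSystem) (d : G.Dart) : (ρ.facePerm d).fst = d.snd := by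
  rw [facePerm_apply, ρ.fst_rot]
  rfl

theorem facePerm_ne_self (ρ : G.RotationSystem) (d : G.Dart) : ρ.facePerm d ≠ d := by
  intro h
  have h1 := ρ.fst_facePerm d
  rw [h] at h1
  exact d.fst_ne_snd h1

/-- Since `rot` is transitive on the darts at a vertex, a fixed dart would be the only one there,
against degree at least two. -/
theorem rot_ne_self (ρ : G.RotationSystem)
    (hG : ∀ v, ∃ a b, a ≠ b ∧ G.Adj v a ∧ G.Adj v b) (d : G.Dart) : ρ.rot d ≠ d := by
  intro h
  have key : ∀ e : G.Dart, e.fst = d.fst → e = d := by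
    intro e he
    obtain ⟨i, hi⟩ := ρ.sameCycle_rot d e he.symm
    rw [← hi]
    exact Equiv.Perm.zpow_apply_eq_self_of_apply_eq_self h i
  obtain ⟨a, b, hab, ha, hb⟩ := hG d.fst
  have h1 := key ⟨(d.fst, a), ha⟩ rfl
  have h2 := key ⟨(d.fst, b), hb⟩ rfl
  have h3 := congrArg (fun e : G.Dart => e.snd) (h1.trans h2.symm)
  exact hab h3

/-- A face walk of length two returns along the edge it left by, which makes `rot` fix `d.symm`. -/
theorem facePerm_facePerm_ne_self (ρ : G.RotationSystem)
    (hG : ∀ v, ∃ a b, a ≠ b ∧ G.Adj v a ∧ G.Adj v b) (d : G.Dart) :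
    ρ.facePerm (ρ.facePerm d) ≠ d := by
  intro h
  have h1 := ρ.fst_facePerm (ρ.facePerm d)
  rw [h] at h1
  have h2 : ρ.facePerm d = d.symm := by
    ext
    · exact ρ.fst_facePerm d
    · exact h1.symm
  exact ρ.rot_ne_self hG d.symm h2

/-- In a graph of minimum degree at least two every face walk has length at least three. -/
theorem three_mul_card_faceWalk_le [Finite V] (ρ : G.RotationSystem)
    (hG : ∀ v, ∃ a b, a ≠ b ∧ G.Adj v a ∧ G.Adj v b) :
    3 * Nat.card ρ.FaceWalk ≤ Nat.card G.Dart := by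
  have : Finite G.Dart := Finite.of_injective (fun d => d.toProd) Dart.toProd_injective
  -- The first three darts of each face walk, from a chosen start; they are distinct, and different
  -- walks share no dart.
  let c : ρ.FaceWalk × Fin 3 → G.Dart := fun p => (ρ.facePerm ^ (p.2 : ℕ)) (Quotient.out p.1)
  have hc : Function.Injective c := by
    rintro ⟨q, i⟩ ⟨r, j⟩ h
    have hq : q = r := by
      rw [← Quotient.out_eq q, ← Quotient.out_eq r]
      apply Quotient.sound
      have h' : (ρ.facePerm ^ (i : ℕ)) q.out = (ρ.facePerm ^ (j : ℕ)) r.out := h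
      change ρ.facePerm.SameCycle q.out r.out
      rw [← Equiv.Perm.sameCycle_pow_left (n := (i : ℕ)), h', Equiv.Perm.sameCycle_pow_left]
    subst hq
    have h' : (ρ.facePerm ^ (i : ℕ)) q.out = (ρ.facePerm ^ (j : ℕ)) q.out := h
    have h1 := ρ.facePerm_ne_self q.out
    have h2 := ρ.facePerm_facePerm_ne_self hG q.out
    have h3 := ρ.facePerm_ne_self (ρ.facePerm q.out)
    congr 1
    fin_cases i <;> fin_cases j <;> simp_all [pow_succ, Equiv.Perm.mul_apply, eq_comm]
  have := Nat.card_le_card_of_injective c hc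
  rwa [Nat.card_prod, Nat.card_fin, mul_comm] at this

end RotationSystem

variable {V : Type*}

theorem natCard_dart_eq_two_mul [Finite V] (G : SimpleGraph V) :
    Nat.card G.Dart = 2 * Nat.card G.edgeSet := by
  classical
  have := Fintype.ofFinite V
  rw [Nat.card_eq_fintype_card, Nat.card_eq_fintype_card, dart_card_eq_twice_card_edges,
    edgeFinset_card]

/-- A consequence of Euler's formula: a graph of minimum degree at least two with more than three
times as many edges as vertices has genus at least two. -/
theorem two_le_genus_of_card_lt [Finite V] [Nonempty V] (G : SimpleGraph V)
    (hG : ∀ v, ∃ a b, a ≠ b ∧ G.Adj v a ∧ G.Adj v b)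
    (hcard : 6 * Nat.card V < Nat.card G.Dart) : 2 ≤ G.genus := by
  refine le_iInf₂ fun g hg => ?_
  obtain ⟨h, hh, ρ, hρ⟩ := hg
  have hface := ρ.three_mul_card_faceWalk_le hG
  have hedge := G.natCard_dart_eq_two_mul
  have hiso : Nat.card {v : V // ∀ w, ¬ G.Adj v w} = 0 := by
    rw [Nat.card_eq_zero]
    left
    constructor
    rintro ⟨v, hv⟩
    obtain ⟨a, -, -, ha, -⟩ := hG v
    exact hv a ha
  have : Nonempty G.ConnectedComponent := ⟨G.connectedComponentMk (Classical.arbitrary V)⟩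
  have : Finite G.ConnectedComponent := Quot.finite _
  have hcomp : 0 < Nat.card G.ConnectedComponent := Nat.card_pos
  rw [RotationSystem.HasGenus, RotationSystem.numFaces, hiso] at hρ
  -- From `3f ≤ 2m` and `m > 3n`, `n - m + f < 0`, so `2h > 2c ≥ 2`.
  have : 2 ≤ g := by omega
  exact_mod_cast this

end SimpleGraph

/-! ### Arithmetic of the local rings of order sixteen. -/

/-- `u`, `v`, `s` generate the maximal ideal of a local ring of order sixteen with residue field of
two elements, whose maximal ideal squares to the socle `{0, s}`, and the multiplication table of
`u` and `v` is hyperbolic or Euclidean. -/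
structure IsLocalTriple {A : Type*} [CommRing A] (u v s : A) : Prop where
  ne_zero : s ≠ 0
  mul_left : s * u = 0
  mul_right : s * v = 0
  form : (u * u = 0 ∧ v * v = 0 ∧ u * v = s) ∨ (u * u = s ∧ v * v = s ∧ u * v = 0)
  two : ∃ a b c : ℤ, (2 : A) = a * u + b * v + c * s
  span : ∀ x : A, ∃ e a b c : ℤ, x = e + a * u + b * v + c * s

namespace IsLocalTriple

variable {A : Type*} [CommRing A] {u v s : A}

theorem sq_socle (h : IsLocalTriple u v s) : s * s = 0 := by
  have h1 := h.mul_left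
  have h2 := h.mul_right
  obtain ⟨-, -, h3⟩ | ⟨h3, -, -⟩ := h.form
  · linear_combination v * h1 - s * h3
  · linear_combination u * h1 - s * h3

theorem two_mul_socle (h : IsLocalTriple u v s) : 2 * s = 0 := by
  obtain ⟨a, b, c, h2⟩ := h.two
  linear_combination s * h2 + a * h.mul_left + b * h.mul_right + c * h.sq_socle

theorem intCast_mul_socle (h : IsLocalTriple u v s) (n : ℤ) : (n : A) * s = 0 ↔ Even n := by
  have h2 := h.two_mul_socle
  constructor
  · intro hn
    by_contra ho
    obtain ⟨k, rfl⟩ := Int.not_even_iff_odd.1 ho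
    apply h.ne_zero
    push_cast at hn
    linear_combination hn - k * h2
  · rintro ⟨k, rfl⟩
    push_cast
    linear_combination k * h2

/-- The element of the maximal ideal with given coordinates. -/
def elem (u v s : A) (p : Fin 2 × Fin 2 × Fin 2) : A :=
  ((p.1 : ℕ) : ℤ) * u + ((p.2.1 : ℕ) : ℤ) * v + ((p.2.2 : ℕ) : ℤ) * s

/-- The bilinear form that gives the product of the elements with the given coordinates, for the
hyperbolic (`false`) and the Euclidean (`true`) multiplication table. -/
def tableForm (t : Bool) (p q : Fin 2 × Fin 2 × Fin 2) : ℕ :=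
  if t then p.1 * q.1 + p.2.1 * q.2.1 else p.1 * q.2.1 + p.2.1 * q.1

theorem elem_mul_socle (h : IsLocalTriple u v s) (p : Fin 2 × Fin 2 × Fin 2) :
    elem u v s p * s = 0 := by
  simp only [elem]
  linear_combination (((p.1 : ℕ) : ℤ) : A) * h.mul_left
    + (((p.2.1 : ℕ) : ℤ) : A) * h.mul_right + (((p.2.2 : ℕ) : ℤ) : A) * h.sq_socle

/-- The `s` coordinates drop out because `s` annihilates `u`, `v` and itself. -/
theorem exists_elem_mul_elem (h : IsLocalTriple u v s) :
    ∃ t, ∀ p q, elem u v s p * elem u v s q = ((tableForm t p q : ℕ) : ℤ) * s := by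
  have hu := h.mul_left
  have hv := h.mul_right
  have hs := h.sq_socle
  obtain ⟨t, ht⟩ : ∃ t : Bool, ∀ a b c d : A, (a * u + b * v) * (c * u + d * v) =
      (if t then a * c + b * d else a * d + b * c) * s := by
    obtain ⟨h1, h2, h3⟩ | ⟨h1, h2, h3⟩ := h.form
    · exact ⟨false, fun a b c d => by
        simp only [Bool.false_eq_true, if_false]
        linear_combination a * c * h1 + b * d * h2 + (a * d + b * c) * h3⟩
    · exact ⟨true, fun a b c d => by
        simp only [if_true]
        linear_combination a * c * h1 + b * d * h2 + (a * d + b * c) * h3⟩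
  refine ⟨t, fun p q => ?_⟩
  have hpq := ht (p.1 : ℕ) (p.2.1 : ℕ) (q.1 : ℕ) (q.2.1 : ℕ)
  have : elem u v s p * elem u v s q = (((p.1 : ℕ) : A) * u + ((p.2.1 : ℕ) : A) * v)
      * (((q.1 : ℕ) : A) * u + ((q.2.1 : ℕ) : A) * v) := by
    simp only [elem]
    push_cast
    linear_combination (((p.2.2 : ℕ) : A) * (q.1 : ℕ) + ((q.2.2 : ℕ) : A) * (p.1 : ℕ)) * hu
      + (((p.2.2 : ℕ) : A) * (q.2.1 : ℕ) + ((q.2.2 : ℕ) : A) * (p.2.1 : ℕ)) * hv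
      + ((p.2.2 : ℕ) : A) * (q.2.2 : ℕ) * hs
  rw [this, hpq, tableForm]
  split_ifs <;> push_cast <;> rfl

/-- Turns vanishing of products into parity of a form on finite coordinates, so the later counts can
be decided. -/
theorem exists_elem_mul_elem_eq_zero_iff (h : IsLocalTriple u v s) :
    ∃ t, ∀ p q, elem u v s p * elem u v s q = 0 ↔ Even (tableForm t p q) := by
  obtain ⟨t, ht⟩ := h.exists_elem_mul_elem
  refine ⟨t, fun p q => ?_⟩
  rw [ht, h.intCast_mul_socle, Int.even_coe_nat]

/-- The elements `u`, `v`, `s` are linearly independent modulo two. -/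
theorem even_of_comb_eq_zero (h : IsLocalTriple u v s) {a b c : ℤ}
    (h0 : a * u + b * v + c * s = 0) : Even a ∧ Even b ∧ a * u + b * v = c * s := by
  have hu := h.mul_left
  have hv := h.mul_right
  have hs := h.two_mul_socle
  simp only [← h.intCast_mul_socle]
  obtain ⟨h1, h2, h3⟩ | ⟨h1, h2, h3⟩ := h.form
  · refine ⟨?_, ?_, ?_⟩
    · linear_combination v * h0 - b * h2 - a * h3 - c * hv
    · linear_combination u * h0 - a * h1 - b * h3 - c * hu
    · linear_combination h0 - c * hs
  · refine ⟨?_, ?_, ?_⟩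
    · linear_combination u * h0 - a * h1 - b * h3 - c * hu
    · linear_combination v * h0 - b * h2 - a * h3 - c * hv
    · linear_combination h0 - c * hs

theorem elem_injective (h : IsLocalTriple u v s) : Function.Injective (elem u v s) := by
  rintro ⟨a, b, c⟩ ⟨a', b', c'⟩ he
  simp only [elem] at he
  have h0 : (((a : ℕ) - (a' : ℕ) : ℤ) : A) * u + (((b : ℕ) - (b' : ℕ) : ℤ) : A) * v
      + (((c : ℕ) - (c' : ℕ) : ℤ) : A) * s = 0 := by
    push_cast at he ⊢
    linear_combination he
  obtain ⟨ha, hb, hc⟩ := h.even_of_comb_eq_zero h0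
  have ha' : a = a' := by
    obtain ⟨k, hk⟩ := ha
    omega
  have hb' : b = b' := by
    obtain ⟨k, hk⟩ := hb
    omega
  subst ha' hb'
  simp only [sub_self, Int.cast_zero, zero_mul, zero_add] at hc
  obtain ⟨k, hk⟩ := (h.intCast_mul_socle _).1 hc.symm
  have hc' : c = c' := by omega
  rw [hc']

/-- An integer combination of `u`, `v`, `s` can be written with coefficients `0` and `1`. -/
theorem exists_elem_eq (h : IsLocalTriple u v s) (a b c : ℤ) :
    ∃ p, elem u v s p = a * u + b * v + c * s := by
  have hs := h.two_mul_socle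
  obtain ⟨l, m, n, h2⟩ := h.two
  have key : ∃ i j : ℤ, 2 * u = i * s ∧ 2 * v = j * s := by
    have hu := h.mul_left
    have hv := h.mul_right
    obtain ⟨h1, h3, h4⟩ | ⟨h1, h3, h4⟩ := h.form
    · exact ⟨m, l, by linear_combination u * h2 + l * h1 + m * h4 + n * hu,
        by linear_combination v * h2 + l * h4 + m * h3 + n * hv⟩
    · exact ⟨l, m, by linear_combination u * h2 + l * h1 + m * h4 + n * hu,
        by linear_combination v * h2 + l * h4 + m * h3 + n * hv⟩
  obtain ⟨i, j, hi, hj⟩ := key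
  have fin : ∀ z : ℤ, ∃ (r : Fin 2) (q : ℤ), z = (r : ℕ) + 2 * q := fun z =>
    ⟨⟨(z % 2).toNat, by omega⟩, z / 2, by simp only; omega⟩
  obtain ⟨a₀, a₁, rfl⟩ := fin a
  obtain ⟨b₀, b₁, rfl⟩ := fin b
  -- The even parts of `a` and `b` carry into the socle, as `2 * u` and `2 * v` are multiples of
  -- `s`.
  obtain ⟨c₀, c₁, hc⟩ := fin (c + a₁ * i + b₁ * j)
  refine ⟨(a₀, b₀, c₀), ?_⟩
  have hc' : (c : A) + a₁ * i + b₁ * j = (c₀ : ℕ) + 2 * c₁ := by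
    exact_mod_cast congrArg (Int.cast : ℤ → A) hc
  simp only [elem]
  push_cast
  linear_combination (-a₁ : A) * hi - b₁ * hj - c₁ * hs - s * hc'

/-- An even constant term is absorbed through the expression for 2; an odd one gives 1 plus a
nilpotent, a unit, which cannot be a zero divisor. -/
theorem eq_elem_of_mul_eq_zero (h : IsLocalTriple u v s) {x y : A} (hy : y ≠ 0)
    (hxy : x * y = 0) : ∃ p, elem u v s p = x := by
  obtain ⟨e, a, b, c, rfl⟩ := h.span x
  obtain ⟨l, m, n, h2⟩ := h.two
  obtain ⟨k, rfl | rfl⟩ := Int.even_or_odd' e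
  · obtain ⟨p, hp⟩ := h.exists_elem_eq (a + k * l) (b + k * m) (c + k * n)
    refine ⟨p, hp.trans ?_⟩
    push_cast
    linear_combination -k * h2
  · exfalso
    obtain ⟨p, hp⟩ := h.exists_elem_eq (a + k * l) (b + k * m) (c + k * n)
    obtain ⟨t, ht⟩ := h.exists_elem_mul_elem
    have hx : ((2 * k + 1 : ℤ) : A) + a * u + b * v + c * s = 1 + elem u v s p := by
      rw [hp]
      push_cast
      linear_combination k * h2
    rw [hx] at hxy
    have hcube : elem u v s p * (elem u v s p * elem u v s p) = 0 := by
      rw [ht]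
      linear_combination ((tableForm t p p : ℕ) : ℤ) * h.elem_mul_socle p
    apply hy
    -- With `m = elem u v s p` and `m³ = 0`, the inverse of `1 + m` is `1 - m + m²`.
    linear_combination (1 - elem u v s p + elem u v s p * elem u v s p) * hxy - y * hcube

/-- The nonzero zero divisors. -/
def zeroDivisors (A : Type*) [CommRing A] : Set A := {x | x ≠ 0 ∧ ∃ y, y ≠ 0 ∧ x * y = 0}

/-- Coordinates on the nonzero zero divisors. -/
noncomputable def equivZeroDivisors (h : IsLocalTriple u v s) :
    {p : Fin 2 × Fin 2 × Fin 2 // p ≠ 0} ≃ zeroDivisors A :=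
  Equiv.ofBijective (fun p => ⟨elem u v s p, by
    have h0 : elem u v s 0 = 0 := by simp [elem]
    refine ⟨fun hp => p.2 (h.elem_injective (hp.trans h0.symm)), s, h.ne_zero, h.elem_mul_socle p⟩⟩) (by
    constructor
    · intro p q hpq
      exact Subtype.ext (h.elem_injective (congrArg Subtype.val hpq))
    · rintro ⟨x, hx0, y, hy, hxy⟩
      obtain ⟨p, hp⟩ := h.eq_elem_of_mul_eq_zero hy hxy
      refine ⟨⟨p, ?_⟩, Subtype.ext hp⟩
      rintro rfl
      exact hx0 (by simp [← hp, elem]))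

theorem card_zeroDivisors (h : IsLocalTriple u v s) : Nat.card (zeroDivisors A) = 7 := by
  rw [← Nat.card_congr h.equivZeroDivisors, Nat.card_eq_fintype_card]
  decide

/-- Nondegeneracy gives `4 + 3 * 2 = 10` orthogonal pairs in the `u`, `v` coordinates, hence `10 * 4
= 40` with the `s` coordinates; 15 of these involve zero. -/
theorem card_zeroDivisors_pairs (h : IsLocalTriple u v s) :
    Nat.card {p : zeroDivisors A × zeroDivisors A // (p.1 : A) * p.2 = 0} = 25 := by
  obtain ⟨t, ht⟩ := h.exists_elem_mul_elem_eq_zero_iff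
  rw [← Nat.card_congr ((h.equivZeroDivisors.prodCongr h.equivZeroDivisors).subtypeEquiv
    (p := fun p => Even (tableForm t p.1.1 p.2.1)) fun p => (ht _ _).symm), Nat.card_eq_fintype_card]
  cases t <;> decide

theorem exists_ne_mul_eq_zero (h : IsLocalTriple u v s) (x : zeroDivisors A) :
    ∃ y : zeroDivisors A, y ≠ x ∧ (x : A) * y = 0 := by
  obtain ⟨t, ht⟩ := h.exists_elem_mul_elem_eq_zero_iff
  obtain ⟨p, rfl⟩ := h.equivZeroDivisors.surjective x
  have key : ∀ p : {p : Fin 2 × Fin 2 × Fin 2 // p ≠ 0},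
      ∃ q : {p : Fin 2 × Fin 2 × Fin 2 // p ≠ 0}, q ≠ p ∧ Even (tableForm t p q) := by
    cases t <;> decide
  obtain ⟨q, hq, hpq⟩ := key p
  exact ⟨h.equivZeroDivisors q, h.equivZeroDivisors.injective.ne hq, (ht _ _).2 hpq⟩

end IsLocalTriple

/-! ### From the quotient ring to the graph on `R`. -/

open IsLocalTriple

/-- A finite ring is in bijection with the product of the image and the kernel of a surjective
homomorphism. -/
theorem exists_equiv_prod_ker {R B : Type*} [CommRing R] [CommRing B] (π : R →+* B)
    (hπ : Function.Surjective π) :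
    ∃ E : R ≃ B × RingHom.ker π, ∀ x, (E x).1 = π x := by
  choose σ hσ using hπ
  refine ⟨⟨fun x => (π x, ⟨x - σ (π x), by simp [RingHom.mem_ker, hσ]⟩),
    fun p => σ p.1 + p.2, fun x => by simp, ?_⟩, fun x => rfl⟩
  rintro ⟨b, i, hi⟩
  have hi' : π i = 0 := hi
  have : π (σ b + i) = b := by rw [map_add, hσ, hi', add_zero]
  ext <;> simp [this]

section

variable {R B : Type*} [CommRing R] [CommRing B] (π : R →+* B)

theorem zeroDivisorGraph_vertex_iff (hπ : Function.Surjective π) (x : R) :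
    (x ∉ RingHom.ker π ∧ ∃ y, y ∉ RingHom.ker π ∧ x * y ∈ RingHom.ker π) ↔
      π x ∈ zeroDivisors B := by
  simp only [RingHom.mem_ker, zeroDivisors, Set.mem_ofPred_eq, map_mul]
  rw [hπ.exists]

/-- The vertices of the zero-divisor graph with respect to the kernel of a homomorphism are the
copies of the nonzero zero divisors of the image, one for each element of the kernel. -/
theorem exists_zeroDivisorGraph_vertex_equiv (hπ : Function.Surjective π) :
    ∃ E : {x : R // x ∉ RingHom.ker π ∧ ∃ y, y ∉ RingHom.ker π ∧ x * y ∈ RingHom.ker π} ≃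
      zeroDivisors B × RingHom.ker π, ∀ x, ((E x).1 : B) = π x := by
  obtain ⟨E, hE⟩ := exists_equiv_prod_ker π hπ
  let F : {p : B × RingHom.ker π // p.1 ∈ zeroDivisors B} ≃ zeroDivisors B × RingHom.ker π :=
    Equiv.prodSubtypeFstEquivSubtypeProd
  exact ⟨(E.subtypeEquiv fun x => by rw [zeroDivisorGraph_vertex_iff π hπ, hE]).trans F, fun x => hE x⟩

theorem two_le_genus_zeroDivisorGraph_ker [Finite R] {u v s : B} (h : IsLocalTriple u v s)
    (hπ : Function.Surjective π) (hker : RingHom.ker π ≠ ⊥) :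
    2 ≤ (zeroDivisorGraph (RingHom.ker π)).genus := by
  classical
  set G := zeroDivisorGraph (RingHom.ker π) with hG
  obtain ⟨E, hE⟩ := exists_zeroDivisorGraph_vertex_equiv π hπ
  have hadj : ∀ x y, G.Adj x y ↔ x ≠ y ∧ ((E x).1 : B) * (E y).1 = 0 := by
    intro x y
    rw [hE, hE, ← map_mul, ← RingHom.mem_ker]
    rfl
  have hnontrivial : Nontrivial (RingHom.ker π) := Submodule.nontrivial_iff_ne_bot.2 hker
  have hk : 2 ≤ Nat.card (RingHom.ker π) := Finite.one_lt_card
  have hZ := h.card_zeroDivisors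
  have hP := h.card_zeroDivisors_pairs
  have hB : Finite B := Finite.of_surjective π hπ
  have hV := Nat.card_congr E
  rw [Nat.card_prod, hZ] at hV
  have : Nonempty {x : R // x ∉ RingHom.ker π ∧ ∃ y, y ∉ RingHom.ker π ∧ x * y ∈ RingHom.ker π} :=
    (Nat.card_pos_iff.1 (by omega)).1
  refine G.two_le_genus_of_card_lt (fun x => ?_) ?_
  · obtain ⟨b, hb, hxb⟩ := h.exists_ne_mul_eq_zero (E x).1
    obtain ⟨i, hi⟩ := exists_ne (0 : RingHom.ker π)
    -- All copies of `b` are neighbours of `x`; the copies at `i` and `0` are two different ones.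
    have key : ∀ j, G.Adj x (E.symm (b, j)) := by
      intro j
      rw [hadj, Equiv.apply_symm_apply]
      refine ⟨?_, hxb⟩
      rintro rfl
      simp at hb
    exact ⟨_, _, fun he => hi (congrArg Prod.snd (E.symm.injective he)), key i, key 0⟩
  · have : Finite G.Dart :=
      Finite.of_injective (fun d => d.toProd) SimpleGraph.Dart.toProd_injective
    have hdart : 25 * Nat.card (RingHom.ker π) ^ 2 ≤
        Nat.card G.Dart + 7 * Nat.card (RingHom.ker π) := by
      rw [← hV, ← hP, sq, ← Nat.card_prod, ← Nat.card_prod, ← Nat.card_sum]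
      let c : G.Dart ⊕ {x : R // x ∉ RingHom.ker π ∧ ∃ y, y ∉ RingHom.ker π ∧ x * y ∈ RingHom.ker π}
        → _ × _ := Sum.elim (fun d => d.toProd) (fun x => (x, x))
      let f : {p : zeroDivisors B × zeroDivisors B // (p.1 : B) * p.2 = 0} ×
          (RingHom.ker π × RingHom.ker π) → _ × _ :=
        fun p => (E.symm (p.1.1.1, p.2.1), E.symm (p.1.1.2, p.2.2))
      -- Each of the `25k²` lifted pairs is either a dart or a diagonal pair, the latter indexed by
      -- its vertex.
      have hf : ∀ p, ∃ q, c q = f p := by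
        intro p
        by_cases hp : (f p).1 = (f p).2
        · exact ⟨Sum.inr (f p).1, Prod.ext rfl hp⟩
        · refine ⟨Sum.inl ⟨f p, (hadj _ _).2 ⟨hp, ?_⟩⟩, rfl⟩
          simpa [f] using p.1.2
      choose g hg using hf
      refine Nat.card_le_card_of_injective g fun p q hpq => ?_
      have he : f p = f q := by rw [← hg, ← hg, hpq]
      have h1 := E.symm.injective (congrArg Prod.fst he)
      have h2 := E.symm.injective (congrArg Prod.snd he)
      simp only [Prod.mk.injEq] at h1 h2
      exact Prod.ext (Subtype.ext (Prod.ext h1.1 h2.1)) (Prod.ext h1.2 h2.2)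
    rw [hV]
    -- The claim is `42k < 25k² - 7k`, true exactly from `k = 2` on for positive `k`.
    nlinarith

/-- The zero-divisor graph with respect to a nonzero ideal has genus at least two when the quotient
is one of the local rings of order sixteen described by `IsLocalTriple`. -/
theorem two_le_genus_zeroDivisorGraph [Finite R] (I : Ideal R) (hI : I ≠ ⊥)
    (e : R ⧸ I ≃+* B) {u v s : B} (h : IsLocalTriple u v s) :
    2 ≤ (zeroDivisorGraph I).genus := by
  have hker : RingHom.ker ((e : R ⧸ I →+* B).comp (Ideal.Quotient.mk I)) = I := by
    ext x
    simp [RingHom.mem_ker, Ideal.Quotient.eq_zero_iff_mem]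
  -- The vertex type depends on the ideal, so the ideal is generalized before the equality is
  -- substituted.
  have key : ∀ J, RingHom.ker ((e : R ⧸ I →+* B).comp (Ideal.Quotient.mk I)) = J → J ≠ ⊥ →
      2 ≤ (zeroDivisorGraph J).genus := by
    rintro _ rfl
    exact two_le_genus_zeroDivisorGraph_ker _ h (e.surjective.comp Ideal.Quotient.mk_surjective)
  exact key I hker hI

end

/-! ### Tools for presented rings: detecting nonzero elements and spanning. -/

/-- An additive functional that kills all multiples of the generators kills the ideal. -/
theorem notMem_span_of_addMonoidHom {P M : Type*} [CommRing P] [AddCommGroup M] (φ : P →+ M)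
    {S : Set P} (hS : ∀ g ∈ S, ∀ q, φ (q * g) = 0) {p : P} (hp : φ p ≠ 0) :
    p ∉ Ideal.span S := by
  intro h
  -- Quantifying over multipliers lets the induction pass through scalar multiples, since `φ` is
  -- only additive.
  have key : ∀ q, φ (q * p) = 0 := by
    clear hp
    induction h using Submodule.span_induction with
    | mem x hx => exact hS x hx
    | zero => simp
    | add x y _ _ hx hy => intro q; rw [mul_add, map_add, hx, hy, add_zero]
    | smul a x _ hx => intro q; rw [smul_eq_mul, ← mul_assoc, hx]
  exact hp (by simpa using key 1)

/-- The coefficient of `X ^ a * Y ^ b` of a polynomial in two variables. -/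
noncomputable def coeffTwo {k : Type*} [CommRing k] (a b : ℕ) : MvPolynomial (Fin 2) k →+ k :=
  MvPolynomial.coeffAddMonoidHom (Finsupp.single 0 a + Finsupp.single 1 b)

section

open MvPolynomial

variable {k : Type*} [CommRing k] (a b : ℕ) (q : MvPolynomial (Fin 2) k)

/-- With its companions, strips variables one at a time to evaluate a coefficient of `q` times a
monomial. -/
theorem coeffTwo_succ_mul_X_zero : coeffTwo (a + 1) b (q * X 0) = coeffTwo a b q := by
  simp only [coeffTwo, coeffAddMonoidHom_apply]
  rw [Finsupp.single_add, add_right_comm, coeff_mul_X]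

theorem coeffTwo_succ_mul_X_one : coeffTwo a (b + 1) (q * X 1) = coeffTwo a b q := by
  simp only [coeffTwo, coeffAddMonoidHom_apply]
  rw [Finsupp.single_add, ← add_assoc, coeff_mul_X]

theorem coeffTwo_zero_mul_X_zero : coeffTwo 0 b (q * X 0) = 0 := by
  simp [coeffTwo, coeff_mul_X']

theorem coeffTwo_zero_mul_X_one : coeffTwo a 0 (q * X 1) = 0 := by
  simp [coeffTwo, coeff_mul_X']

theorem coeffTwo_zero_zero_one : coeffTwo 0 0 (1 : MvPolynomial (Fin 2) k) = 1 := by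
  simp [coeffTwo]

theorem coeffTwo_succ_one : coeffTwo (a + 1) b (1 : MvPolynomial (Fin 2) k) = 0 := by
  have h : (0 : Fin 2 →₀ ℕ) ≠ Finsupp.single 0 (a + 1) + Finsupp.single 1 b := fun h => by
    simpa using DFunLike.congr_fun h 0
  rw [coeffTwo, coeffAddMonoidHom_apply, coeff_one, if_neg h]

theorem coeffTwo_one_succ : coeffTwo a (b + 1) (1 : MvPolynomial (Fin 2) k) = 0 := by
  have h : (0 : Fin 2 →₀ ℕ) ≠ Finsupp.single 0 a + Finsupp.single 1 (b + 1) := fun h => by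
    simpa using DFunLike.congr_fun h 1
  rw [coeffTwo, coeffAddMonoidHom_apply, coeff_one, if_neg h]

end

section

variable {A : Type*} [CommRing A] {u v s : A}

/-- The integer combinations of `1`, `u`, `v`, `s` are closed under multiplication by such
combinations. -/
theorem exists_comb_mul (hu : s * u = 0) (hv : s * v = 0)
    (hform : (u * u = 0 ∧ v * v = 0 ∧ u * v = s) ∨ (u * u = s ∧ v * v = s ∧ u * v = 0)) {x y : A}
    (hx : ∃ e a b c : ℤ, x = e + a * u + b * v + c * s)
    (hy : ∃ e a b : ℤ, y = e + a * u + b * v) :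
    ∃ e a b c : ℤ, x * y = e + a * u + b * v + c * s := by
  obtain ⟨e, a, b, c, rfl⟩ := hx
  obtain ⟨e', a', b', rfl⟩ := hy
  obtain ⟨h1, h2, h3⟩ | ⟨h1, h2, h3⟩ := hform
  · refine ⟨e * e', e * a' + a * e', e * b' + b * e', c * e' + a * b' + b * a', ?_⟩
    push_cast
    linear_combination a * a' * h1 + b * b' * h2 + (a * b' + b * a') * h3 + c * a' * hu
      + c * b' * hv
  · refine ⟨e * e', e * a' + a * e', e * b' + b * e', c * e' + a * a' + b * b', ?_⟩
    push_cast
    linear_combination a * a' * h1 + b * b' * h2 + (a * b' + b * a') * h3 + c * a' * hu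
      + c * b' * hv

theorem isLocalTriple_of_mvPolynomial {n : ℕ} (f : MvPolynomial (Fin 2) (ZMod n) →+* A)
    (hf : Function.Surjective f) (hs : s ≠ 0) (hu : s * u = 0) (hv : s * v = 0)
    (hform : (u * u = 0 ∧ v * v = 0 ∧ u * v = s) ∨ (u * u = s ∧ v * v = s ∧ u * v = 0))
    (h2 : ∃ a b c : ℤ, (2 : A) = a * u + b * v + c * s)
    (hfu : f (MvPolynomial.X 0) = u) (hfv : f (MvPolynomial.X 1) = v) : IsLocalTriple u v s where
  ne_zero := hs
  mul_left := hu
  mul_right := hv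
  form := hform
  two := h2
  span x := by
    obtain ⟨p, rfl⟩ := hf x
    induction p using MvPolynomial.induction_on with
    | C a =>
      obtain ⟨m, rfl⟩ := ZMod.intCast_surjective a
      exact ⟨m, 0, 0, 0, by simp⟩
    | add p q hp hq =>
      obtain ⟨e, a, b, c, hp⟩ := hp
      obtain ⟨e', a', b', c', hq⟩ := hq
      refine ⟨e + e', a + a', b + b', c + c', ?_⟩
      push_cast
      rw [map_add]
      linear_combination hp + hq
    | mul_X p i hp =>
      rw [map_mul]
      refine exists_comb_mul hu hv hform hp ?_
      fin_cases i
      · exact ⟨0, 1, 0, by simp [hfu]⟩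
      · exact ⟨0, 0, 1, by simp [hfv]⟩

theorem isLocalTriple_of_polynomial {n : ℕ} (f : Polynomial (ZMod n) →+* A)
    (hf : Function.Surjective f) (hs : s ≠ 0) (hu : s * u = 0) (hv : s * v = 0)
    (hform : (u * u = 0 ∧ v * v = 0 ∧ u * v = s) ∨ (u * u = s ∧ v * v = s ∧ u * v = 0))
    (h2 : ∃ a b c : ℤ, (2 : A) = a * u + b * v + c * s)
    (hX : ∃ e a b : ℤ, f Polynomial.X = e + a * u + b * v) : IsLocalTriple u v s where
  ne_zero := hs
  mul_left := hu
  mul_right := hv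
  form := hform
  two := h2
  span x := by
    obtain ⟨p, rfl⟩ := hf x
    induction p using Polynomial.induction_on with
    | C a =>
      obtain ⟨m, rfl⟩ := ZMod.intCast_surjective a
      exact ⟨m, 0, 0, 0, by simp⟩
    | add p q hp hq =>
      obtain ⟨e, a, b, c, hp⟩ := hp
      obtain ⟨e', a', b', c', hq⟩ := hq
      refine ⟨e + e', a + a', b + b', c + c', ?_⟩
      push_cast
      rw [map_add]
      linear_combination hp + hq
    | monomial m a hp =>
      rw [pow_succ, ← mul_assoc, map_mul]
      exact exists_comb_mul hu hv hform hp hX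

end

theorem ofNat_eq_zero_of_ringHom {k A : Type*} [CommRing k] [CommRing A] (f : k →+* A) {n : ℕ}
    [n.AtLeastTwo] (h : (OfNat.ofNat n : k) = 0) : (OfNat.ofNat n : A) = 0 := by
  rw [← map_ofNat f n, h, map_zero]

/-! ### Triples in the seven rings. -/

set_option linter.unusedSimpArgs false

section

open MvPolynomial

/-- `ℤ₄[x, y] / (x², y², xy - 2)` is a local ring as described by
`IsLocalTriple`. -/
theorem exists_isLocalTriple_hyperbolic_zmod_four :
    ∃ u v s : MvPolynomial (Fin 2) (ZMod 4) ⧸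
      (Ideal.span {X 0 ^ 2, X 1 ^ 2, X 0 * X 1 - 2} : Ideal (MvPolynomial (Fin 2) (ZMod 4))),
      IsLocalTriple u v s := by
  set J : Ideal (MvPolynomial (Fin 2) (ZMod 4)) := Ideal.span {X 0 ^ 2, X 1 ^ 2, X 0 * X 1 - 2}
  have h1 : Ideal.Quotient.mk J (X 0 ^ 2) = 0 :=
    Ideal.Quotient.eq_zero_iff_mem.2 (Ideal.subset_span (by simp))
  have h2 : Ideal.Quotient.mk J (X 1 ^ 2) = 0 :=
    Ideal.Quotient.eq_zero_iff_mem.2 (Ideal.subset_span (by simp))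
  have h3 : Ideal.Quotient.mk J (X 0 * X 1 - 2) = 0 :=
    Ideal.Quotient.eq_zero_iff_mem.2 (Ideal.subset_span (by simp))
  have hk : (4 : ZMod 4) = 0 := rfl
  have hs : Ideal.Quotient.mk J (1 + 1) ≠ 0 := by
    rw [Ne, Ideal.Quotient.eq_zero_iff_mem]
    -- The weight 2 on `xy` matches the relation `xy = 2`: on `q * (xy - 2)` only `-4` times a
    -- coefficient survives.
    refine notMem_span_of_addMonoidHom (coeffTwo 0 0 + 2 • coeffTwo 1 1) ?_ ?_
    · rintro g (rfl | rfl | rfl) q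
      all_goals
        simp only [pow_succ, pow_zero, one_mul, mul_sub, mul_two, ← mul_assoc,
          AddMonoidHom.add_apply, AddMonoidHom.smul_apply, map_add, map_sub, nsmul_eq_mul,
          coeffTwo_succ_mul_X_zero, coeffTwo_succ_mul_X_one, coeffTwo_zero_mul_X_zero,
          coeffTwo_zero_mul_X_one]
      · simp
      · simp
      · linear_combination (-(coeffTwo 1 1 q)) * hk
    · simp only [pow_succ, pow_zero, ← mul_assoc, AddMonoidHom.add_apply, AddMonoidHom.smul_apply,
        map_add, coeffTwo_zero_zero_one, coeffTwo_succ_one, coeffTwo_one_succ,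
        coeffTwo_succ_mul_X_zero, coeffTwo_succ_mul_X_one, coeffTwo_zero_mul_X_zero,
        coeffTwo_zero_mul_X_one]
      decide
  simp only [map_sub, map_mul, map_pow, map_add, map_one, map_ofNat] at hs h1 h2 h3
  set x := Ideal.Quotient.mk J (X 0)
  set y := Ideal.Quotient.mk J (X 1)
  refine ⟨x, y, _, isLocalTriple_of_mvPolynomial _ Ideal.Quotient.mk_surjective hs ?_ ?_
    (Or.inl ⟨?_, ?_, ?_⟩) ⟨0, 0, 1, by push_cast; ring⟩ rfl rfl⟩
  · linear_combination y * h1 - x * h3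
  · linear_combination x * h2 - y * h3
  · linear_combination h1
  · linear_combination h2
  · linear_combination h3

/-- `ℤ₂[x, y] / (x², y²)` is a local ring as described by
`IsLocalTriple`. -/
theorem exists_isLocalTriple_hyperbolic_zmod_two :
    ∃ u v s : MvPolynomial (Fin 2) (ZMod 2) ⧸
      (Ideal.span {X 0 ^ 2, X 1 ^ 2} : Ideal (MvPolynomial (Fin 2) (ZMod 2))),
      IsLocalTriple u v s := by
  set J : Ideal (MvPolynomial (Fin 2) (ZMod 2)) := Ideal.span {X 0 ^ 2, X 1 ^ 2}
  have h1 : Ideal.Quotient.mk J (X 0 ^ 2) = 0 :=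
    Ideal.Quotient.eq_zero_iff_mem.2 (Ideal.subset_span (by simp))
  have h2 : Ideal.Quotient.mk J (X 1 ^ 2) = 0 :=
    Ideal.Quotient.eq_zero_iff_mem.2 (Ideal.subset_span (by simp))
  have hn : (2 : MvPolynomial (Fin 2) (ZMod 2) ⧸ J) = 0 :=
    ofNat_eq_zero_of_ringHom ((Ideal.Quotient.mk J).comp C) rfl
  have hs : Ideal.Quotient.mk J (X 0 * X 1) ≠ 0 := by
    rw [Ne, Ideal.Quotient.eq_zero_iff_mem]
    refine notMem_span_of_addMonoidHom (coeffTwo 1 1) ?_ ?_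
    · rintro g (rfl | rfl) q
      all_goals
        simp only [pow_succ, pow_zero, one_mul, mul_sub, mul_two, ← mul_assoc,
          AddMonoidHom.add_apply, AddMonoidHom.smul_apply, map_add, map_sub, nsmul_eq_mul,
          coeffTwo_succ_mul_X_zero, coeffTwo_succ_mul_X_one, coeffTwo_zero_mul_X_zero,
          coeffTwo_zero_mul_X_one]
    · rw [← one_mul (X 0 * X 1)]
      simp only [pow_succ, pow_zero, ← mul_assoc, AddMonoidHom.add_apply, AddMonoidHom.smul_apply,
        map_add, coeffTwo_zero_zero_one, coeffTwo_succ_one, coeffTwo_one_succ,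
        coeffTwo_succ_mul_X_zero, coeffTwo_succ_mul_X_one, coeffTwo_zero_mul_X_zero,
        coeffTwo_zero_mul_X_one]
      decide
  simp only [map_sub, map_mul, map_pow, map_add, map_one, map_ofNat] at hs h1 h2
  set x := Ideal.Quotient.mk J (X 0)
  set y := Ideal.Quotient.mk J (X 1)
  refine ⟨x, y, _, isLocalTriple_of_mvPolynomial _ Ideal.Quotient.mk_surjective hs ?_ ?_
    (Or.inl ⟨?_, ?_, ?_⟩) ⟨0, 0, 0, by push_cast; linear_combination hn⟩ rfl rfl⟩
  · linear_combination y * h1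
  · linear_combination x * h2
  · linear_combination h1
  · linear_combination h2
  · ring

/-- `ℤ₂[x, y] / (x³, xy, y² - x²)` is a local ring as described by
`IsLocalTriple`. -/
theorem exists_isLocalTriple_euclidean_zmod_two :
    ∃ u v s : MvPolynomial (Fin 2) (ZMod 2) ⧸
      (Ideal.span {X 0 ^ 3, X 0 * X 1, X 1 ^ 2 - X 0 ^ 2} : Ideal (MvPolynomial (Fin 2) (ZMod 2))),
      IsLocalTriple u v s := by
  set J : Ideal (MvPolynomial (Fin 2) (ZMod 2)) :=
    Ideal.span {X 0 ^ 3, X 0 * X 1, X 1 ^ 2 - X 0 ^ 2}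
  have h1 : Ideal.Quotient.mk J (X 0 ^ 3) = 0 :=
    Ideal.Quotient.eq_zero_iff_mem.2 (Ideal.subset_span (by simp))
  have h2 : Ideal.Quotient.mk J (X 0 * X 1) = 0 :=
    Ideal.Quotient.eq_zero_iff_mem.2 (Ideal.subset_span (by simp))
  have h3 : Ideal.Quotient.mk J (X 1 ^ 2 - X 0 ^ 2) = 0 :=
    Ideal.Quotient.eq_zero_iff_mem.2 (Ideal.subset_span (by simp))
  have hn : (2 : MvPolynomial (Fin 2) (ZMod 2) ⧸ J) = 0 :=
    ofNat_eq_zero_of_ringHom ((Ideal.Quotient.mk J).comp C) rfl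
  have hs : Ideal.Quotient.mk J (X 0 ^ 2) ≠ 0 := by
    rw [Ne, Ideal.Quotient.eq_zero_iff_mem]
    -- Weighting `x²` and `y²` equally respects `y² = x²`.
    refine notMem_span_of_addMonoidHom (coeffTwo 2 0 + coeffTwo 0 2) ?_ ?_
    · rintro g (rfl | rfl | rfl) q
      all_goals
        simp only [pow_succ, pow_zero, one_mul, mul_sub, mul_two, ← mul_assoc,
          AddMonoidHom.add_apply, AddMonoidHom.smul_apply, map_add, map_sub, nsmul_eq_mul,
          coeffTwo_succ_mul_X_zero, coeffTwo_succ_mul_X_one, coeffTwo_zero_mul_X_zero,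
          coeffTwo_zero_mul_X_one]
      · simp
      · simp
      · simp
    · simp only [pow_succ, pow_zero, ← mul_assoc, AddMonoidHom.add_apply, AddMonoidHom.smul_apply,
        map_add, coeffTwo_zero_zero_one, coeffTwo_succ_one, coeffTwo_one_succ,
        coeffTwo_succ_mul_X_zero, coeffTwo_succ_mul_X_one, coeffTwo_zero_mul_X_zero,
        coeffTwo_zero_mul_X_one]
      decide
  simp only [map_sub, map_mul, map_pow, map_add, map_one, map_ofNat] at hs h1 h2 h3
  set x := Ideal.Quotient.mk J (X 0)
  set y := Ideal.Quotient.mk J (X 1)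
  refine ⟨x, y, _, isLocalTriple_of_mvPolynomial _ Ideal.Quotient.mk_surjective hs ?_ ?_
    (Or.inr ⟨?_, ?_, ?_⟩) ⟨0, 0, 0, by push_cast; linear_combination hn⟩ rfl rfl⟩
  · linear_combination h1
  · linear_combination x * h2
  · ring
  · linear_combination h3
  · linear_combination h2

/-- `ℤ₄[x, y] / (x³, x² - 2, xy, y² - 2)` is a local ring as described by
`IsLocalTriple`. -/
theorem exists_isLocalTriple_euclidean_zmod_four :
    ∃ u v s : MvPolynomial (Fin 2) (ZMod 4) ⧸
      (Ideal.span {X 0 ^ 3, X 0 ^ 2 - 2, X 0 * X 1, X 1 ^ 2 - 2} : Ideal (MvPolynomial (Fin 2) (ZMod 4))),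
      IsLocalTriple u v s := by
  set J : Ideal (MvPolynomial (Fin 2) (ZMod 4)) :=
    Ideal.span {X 0 ^ 3, X 0 ^ 2 - 2, X 0 * X 1, X 1 ^ 2 - 2}
  have h1 : Ideal.Quotient.mk J (X 0 ^ 3) = 0 :=
    Ideal.Quotient.eq_zero_iff_mem.2 (Ideal.subset_span (by simp))
  have h2 : Ideal.Quotient.mk J (X 0 ^ 2 - 2) = 0 :=
    Ideal.Quotient.eq_zero_iff_mem.2 (Ideal.subset_span (by simp))
  have h3 : Ideal.Quotient.mk J (X 0 * X 1) = 0 :=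
    Ideal.Quotient.eq_zero_iff_mem.2 (Ideal.subset_span (by simp))
  have h4 : Ideal.Quotient.mk J (X 1 ^ 2 - 2) = 0 :=
    Ideal.Quotient.eq_zero_iff_mem.2 (Ideal.subset_span (by simp))
  have hk : (4 : ZMod 4) = 0 := rfl
  have hs : Ideal.Quotient.mk J (1 + 1) ≠ 0 := by
    rw [Ne, Ideal.Quotient.eq_zero_iff_mem]
    refine notMem_span_of_addMonoidHom (coeffTwo 0 0 + 2 • (coeffTwo 2 0 + coeffTwo 0 2)) ?_ ?_
    · rintro g (rfl | rfl | rfl | rfl) q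
      all_goals
        simp only [pow_succ, pow_zero, one_mul, mul_sub, mul_two, ← mul_assoc,
          AddMonoidHom.add_apply, AddMonoidHom.smul_apply, map_add, map_sub, nsmul_eq_mul,
          coeffTwo_succ_mul_X_zero, coeffTwo_succ_mul_X_one, coeffTwo_zero_mul_X_zero,
          coeffTwo_zero_mul_X_one]
      · simp
      · linear_combination (-(coeffTwo 2 0 q) - coeffTwo 0 2 q) * hk
      · simp
      · linear_combination (-(coeffTwo 2 0 q) - coeffTwo 0 2 q) * hk
    · simp only [pow_succ, pow_zero, ← mul_assoc, AddMonoidHom.add_apply, AddMonoidHom.smul_apply,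
        map_add, coeffTwo_zero_zero_one, coeffTwo_succ_one, coeffTwo_one_succ,
        coeffTwo_succ_mul_X_zero, coeffTwo_succ_mul_X_one, coeffTwo_zero_mul_X_zero,
        coeffTwo_zero_mul_X_one]
      decide
  simp only [map_sub, map_mul, map_pow, map_add, map_one, map_ofNat] at hs h1 h2 h3 h4
  set x := Ideal.Quotient.mk J (X 0)
  set y := Ideal.Quotient.mk J (X 1)
  refine ⟨x, y, _, isLocalTriple_of_mvPolynomial _ Ideal.Quotient.mk_surjective hs ?_ ?_
    (Or.inr ⟨?_, ?_, ?_⟩) ⟨0, 0, 1, by push_cast; ring⟩ rfl rfl⟩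
  · linear_combination h1 - x * h2
  · linear_combination x * h3 - y * h2
  · linear_combination h2
  · linear_combination h4
  · linear_combination h3

end

section

open Polynomial

/-- `ℤ₄[x] / (x²)` is a local ring as described by
`IsLocalTriple`. -/
theorem exists_isLocalTriple_dualNumber :
    ∃ u v s : Polynomial (ZMod 4) ⧸
      (Ideal.span {X ^ 2} : Ideal (Polynomial (ZMod 4))),
      IsLocalTriple u v s := by
  set J : Ideal (Polynomial (ZMod 4)) := Ideal.span {X ^ 2}
  have h1 : Ideal.Quotient.mk J (X ^ 2) = 0 :=
    Ideal.Quotient.eq_zero_iff_mem.2 (Ideal.subset_span (by simp))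
  have hn : (4 : Polynomial (ZMod 4) ⧸ J) = 0 :=
    ofNat_eq_zero_of_ringHom ((Ideal.Quotient.mk J).comp C) rfl
  have hs : Ideal.Quotient.mk J (2 * X) ≠ 0 := by
    rw [Ne, Ideal.Quotient.eq_zero_iff_mem]
    refine notMem_span_of_addMonoidHom (lcoeff (ZMod 4) 1).toAddMonoidHom
      ?_ ?_
    · rintro g rfl q
      all_goals
        simp only [LinearMap.toAddMonoidHom_coe, LinearMap.add_apply, LinearMap.smul_apply,
          lcoeff_apply, pow_succ, pow_zero, one_mul, mul_sub, mul_two, ← mul_assoc, mul_add, add_mul,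
          coeff_add, coeff_sub, coeff_mul_X, coeff_mul_X_zero, coeff_mul_ofNat, nsmul_eq_mul]
    · simp only [LinearMap.toAddMonoidHom_coe, LinearMap.add_apply, LinearMap.smul_apply,
        lcoeff_apply, coeff_ofNat_mul, coeff_X, coeff_ofNat_zero, coeff_ofNat_succ]
      decide
  simp only [map_sub, map_mul, map_pow, map_add, map_one, map_ofNat] at hs h1
  set x := Ideal.Quotient.mk J X
  -- Here 2 itself is a generator: `2² = x² = 0` and `2x = s`.
  refine ⟨2, x, _, isLocalTriple_of_polynomial (Ideal.Quotient.mk J)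
    Ideal.Quotient.mk_surjective hs ?_ ?_ (Or.inl ⟨?_, ?_, ?_⟩)
    ⟨1, 0, 0, by push_cast; ring⟩ ⟨0, 0, 1, by push_cast; ring⟩⟩
  · linear_combination x * hn
  · linear_combination 2 * h1
  · linear_combination hn
  · linear_combination h1
  · ring

/-- `ℤ₄[x] / (x³, x² - 2x)` is a local ring as described by
`IsLocalTriple`. -/
theorem exists_isLocalTriple_polynomial_zmod_four :
    ∃ u v s : Polynomial (ZMod 4) ⧸
      (Ideal.span {X ^ 3, X ^ 2 - 2 * X} : Ideal (Polynomial (ZMod 4))),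
      IsLocalTriple u v s := by
  set J : Ideal (Polynomial (ZMod 4)) := Ideal.span {X ^ 3, X ^ 2 - 2 * X}
  have h1 : Ideal.Quotient.mk J (X ^ 3) = 0 :=
    Ideal.Quotient.eq_zero_iff_mem.2 (Ideal.subset_span (by simp))
  have h2 : Ideal.Quotient.mk J (X ^ 2 - 2 * X) = 0 :=
    Ideal.Quotient.eq_zero_iff_mem.2 (Ideal.subset_span (by simp))
  have hn : (4 : Polynomial (ZMod 4) ⧸ J) = 0 :=
    ofNat_eq_zero_of_ringHom ((Ideal.Quotient.mk J).comp C) rfl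
  have hk : (4 : ZMod 4) = 0 := rfl
  have hs : Ideal.Quotient.mk J (2 * X) ≠ 0 := by
    rw [Ne, Ideal.Quotient.eq_zero_iff_mem]
    -- Weight 2 on `X²` imitates `X² = 2X`, with error a multiple of 4.
    refine notMem_span_of_addMonoidHom (lcoeff (ZMod 4) 1 + 2 • lcoeff (ZMod 4) 2).toAddMonoidHom
      ?_ ?_
    · rintro g (rfl | rfl) q
      all_goals
        simp only [LinearMap.toAddMonoidHom_coe, LinearMap.add_apply, LinearMap.smul_apply,
          lcoeff_apply, pow_succ, pow_zero, one_mul, mul_sub, mul_two, ← mul_assoc, mul_add, add_mul,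
          coeff_add, coeff_sub, coeff_mul_X, coeff_mul_X_zero, coeff_mul_ofNat, nsmul_eq_mul]
      · simp
      · push_cast; linear_combination -(q.coeff 1) * hk
    · simp only [LinearMap.toAddMonoidHom_coe, LinearMap.add_apply, LinearMap.smul_apply,
        lcoeff_apply, coeff_ofNat_mul, coeff_X, coeff_ofNat_zero, coeff_ofNat_succ]
      decide
  simp only [map_sub, map_mul, map_pow, map_add, map_one, map_ofNat] at hs h1 h2
  set x := Ideal.Quotient.mk J X
  -- An orthogonal basis: `x² = (x + 2)² = 2x` and `x(x + 2) = 4x = 0`.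
  refine ⟨x, x + 2, _, isLocalTriple_of_polynomial (Ideal.Quotient.mk J)
    Ideal.Quotient.mk_surjective hs ?_ ?_ (Or.inr ⟨?_, ?_, ?_⟩)
    ⟨-1, 1, 0, by push_cast; ring⟩ ⟨0, 1, 0, by push_cast; ring⟩⟩
  · linear_combination 2 * h2 + x * hn
  · linear_combination 2 * h2 + 2 * x * hn
  · linear_combination h2
  · linear_combination h2 + (x + 1) * hn
  · linear_combination h2 + x * hn

/-- `ℤ₈[x] / (x² - 4, 2x)` is a local ring as described by
`IsLocalTriple`. -/
theorem exists_isLocalTriple_polynomial_zmod_eight :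
    ∃ u v s : Polynomial (ZMod 8) ⧸
      (Ideal.span {X ^ 2 - 4, 2 * X} : Ideal (Polynomial (ZMod 8))),
      IsLocalTriple u v s := by
  set J : Ideal (Polynomial (ZMod 8)) := Ideal.span {X ^ 2 - 4, 2 * X}
  have h1 : Ideal.Quotient.mk J (X ^ 2 - 4) = 0 :=
    Ideal.Quotient.eq_zero_iff_mem.2 (Ideal.subset_span (by simp))
  have h2 : Ideal.Quotient.mk J (2 * X) = 0 :=
    Ideal.Quotient.eq_zero_iff_mem.2 (Ideal.subset_span (by simp))
  have hn : (8 : Polynomial (ZMod 8) ⧸ J) = 0 :=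
    ofNat_eq_zero_of_ringHom ((Ideal.Quotient.mk J).comp C) rfl
  have hk : (8 : ZMod 8) = 0 := rfl
  have hs : Ideal.Quotient.mk J 4 ≠ 0 := by
    rw [Ne, Ideal.Quotient.eq_zero_iff_mem]
    -- Weight 4 on `X²` imitates `X² = 4`; the multiples of `2X` give multiples of 8.
    refine notMem_span_of_addMonoidHom (lcoeff (ZMod 8) 0 + 4 • lcoeff (ZMod 8) 2).toAddMonoidHom
      ?_ ?_
    · rintro g (rfl | rfl) q
      all_goals
        simp only [LinearMap.toAddMonoidHom_coe, LinearMap.add_apply, LinearMap.smul_apply,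
          lcoeff_apply, pow_succ, pow_zero, one_mul, mul_sub, mul_two, ← mul_assoc, mul_add, add_mul,
          coeff_add, coeff_sub, coeff_mul_X, coeff_mul_X_zero, coeff_mul_ofNat, nsmul_eq_mul]
      · push_cast; linear_combination -2 * (q.coeff 2) * hk
      · push_cast; linear_combination q.coeff 1 * hk
    · simp only [LinearMap.toAddMonoidHom_coe, LinearMap.add_apply, LinearMap.smul_apply,
        lcoeff_apply, coeff_ofNat_mul, coeff_X, coeff_ofNat_zero, coeff_ofNat_succ]
      decide
  simp only [map_sub, map_mul, map_pow, map_add, map_one, map_ofNat] at hs h1 h2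
  set x := Ideal.Quotient.mk J X
  refine ⟨2, x, _, isLocalTriple_of_polynomial (Ideal.Quotient.mk J)
    Ideal.Quotient.mk_surjective hs ?_ ?_ (Or.inr ⟨?_, ?_, ?_⟩)
    ⟨1, 0, 0, by push_cast; ring⟩ ⟨0, 0, 1, by push_cast; ring⟩⟩
  · linear_combination hn
  · linear_combination 2 * h2
  · ring
  · linear_combination h1
  · linear_combination h2

end

theorem mainTheorem5 {R : Type*} [CommRing R] [Finite R] (I : Ideal R)
    (hI_proper : I ≠ ⊤) (hI_nonzero : I ≠ ⊥) :
    ((Nonempty (R ⧸ I ≃+* MvPolynomial (Fin 2) (ZMod 4) ⧸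
          (Ideal.span {MvPolynomial.X 0 ^ 2, MvPolynomial.X 1 ^ 2,
            MvPolynomial.X 0 * MvPolynomial.X 1 - 2} : Ideal (MvPolynomial (Fin 2) (ZMod 4)))) ∨
        Nonempty (R ⧸ I ≃+* MvPolynomial (Fin 2) (ZMod 2) ⧸
          (Ideal.span {MvPolynomial.X 0 ^ 2, MvPolynomial.X 1 ^ 2} :
            Ideal (MvPolynomial (Fin 2) (ZMod 2)))) ∨
        Nonempty (R ⧸ I ≃+* Polynomial (ZMod 4) ⧸
          (Ideal.span {Polynomial.X ^ 2} : Ideal (Polynomial (ZMod 4))))) →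
      2 ≤ (zeroDivisorGraph I).genus) ∧
    ((Nonempty (R ⧸ I ≃+* MvPolynomial (Fin 2) (ZMod 2) ⧸
          (Ideal.span {MvPolynomial.X 0 ^ 3, MvPolynomial.X 0 * MvPolynomial.X 1,
            MvPolynomial.X 1 ^ 2 - MvPolynomial.X 0 ^ 2} :
            Ideal (MvPolynomial (Fin 2) (ZMod 2)))) ∨
        Nonempty (R ⧸ I ≃+* Polynomial (ZMod 4) ⧸
          (Ideal.span {Polynomial.X ^ 3, Polynomial.X ^ 2 - 2 * Polynomial.X} :
            Ideal (Polynomial (ZMod 4)))) ∨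
        Nonempty (R ⧸ I ≃+* MvPolynomial (Fin 2) (ZMod 4) ⧸
          (Ideal.span {MvPolynomial.X 0 ^ 3, MvPolynomial.X 0 ^ 2 - 2,
            MvPolynomial.X 0 * MvPolynomial.X 1, MvPolynomial.X 1 ^ 2 - 2} :
            Ideal (MvPolynomial (Fin 2) (ZMod 4)))) ∨
        Nonempty (R ⧸ I ≃+* Polynomial (ZMod 8) ⧸
          (Ideal.span {Polynomial.X ^ 2 - 4, 2 * Polynomial.X} :
            Ideal (Polynomial (ZMod 8))))) →
      2 ≤ (zeroDivisorGraph I).genus) := by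
  constructor
  · rintro (⟨⟨e⟩⟩ | ⟨⟨e⟩⟩ | ⟨⟨e⟩⟩)
    · obtain ⟨_, _, _, h⟩ := exists_isLocalTriple_hyperbolic_zmod_four
      exact two_le_genus_zeroDivisorGraph I hI_nonzero e h
    · obtain ⟨_, _, _, h⟩ := exists_isLocalTriple_hyperbolic_zmod_two
      exact two_le_genus_zeroDivisorGraph I hI_nonzero e h
    · obtain ⟨_, _, _, h⟩ := exists_isLocalTriple_dualNumber
      exact two_le_genus_zeroDivisorGraph I hI_nonzero e h
  · rintro (⟨⟨e⟩⟩ | ⟨⟨e⟩⟩ | ⟨⟨e⟩⟩ | ⟨⟨e⟩⟩)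
    · obtain ⟨_, _, _, h⟩ := exists_isLocalTriple_euclidean_zmod_two
      exact two_le_genus_zeroDivisorGraph I hI_nonzero e h
    · obtain ⟨_, _, _, h⟩ := exists_isLocalTriple_polynomial_zmod_four
      exact two_le_genus_zeroDivisorGraph I hI_nonzero e h
    · obtain ⟨_, _, _, h⟩ := exists_isLocalTriple_euclidean_zmod_four
      exact two_le_genus_zeroDivisorGraph I hI_nonzero e h
    · obtain ⟨_, _, _, h⟩ := exists_isLocalTriple_polynomial_zmod_eight
      exact two_le_genus_zeroDivisorGraph I hI_nonzero e h
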